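/- Let $\Gamma$ be an infinite group with unit element $e$ and a finite symmetric generating set $S$ (so $\sigma\in S$ implies $\sigma^{-1}\in S$). Let $\Gamma$ act on configurations indexed by $\Gamma$ by $(g\cdot z)_v=z_{g^{-1}v}$. Let $M$ be a finite set and let $X=(X_\gamma)_{\gamma\in\Gamma}$ be an $M$-valued $\Gamma$-factor-of-IID process, that is, almost surely $X=F(Z)$, where $Z_\gamma$, $\gamma\in\Gamma$, are independent random variables, each uniformly distributed on $[0,1]$, and $F\colon[0,1]^\Gamma\to M^\Gamma$ is a measurable map with $F(g\cdot z)=g\cdot F(z)$ for all $g\in\Gamma$ and all $z\in[0,1]^\Gamma$. Let $H$ denote Shannon entropy. (a) For arbitrary real numbers $\alpha_\sigma\ge 0$, $\sigma\in S$, with $\alpha_\sigma=\alpha_{\sigma^{-1}}$, $$\sum_{\sigma\in S}\alpha_\sigma H(X_e,X_\sigma)\ \ge\ \beta\,H(X_e),\qquad \beta=\inf_{W}\frac{\sum_{\sigma\in S}\alpha_\sigma\,|W\cup\sigma W|}{|W|},$$ where $W$ runs through the nonempty finite subsets of $\Gamma$. (b) If $\Gamma$ is a free group with free generators $s_1,\dots,s_r$,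 then Bowen's $f$-invariant of $X$ is nonnegative: $$f(X)=\inf_{n\ge 0}\Big((1-2r)\,H\big(X_{B_n}\big)+\sum_{i=1}^r H\big(X_{B_n},X_{s_iB_n}\big)\Big)\ \ge\ 0,$$ where $B_n$ is the ball of radius $n$ around $e$ in the word metric of $s_1,\dots,s_r$, and $X_U=(X_\gamma)_{\gamma\in U}$. In particular (the case $n=0$), $\sum_{i=1}^r H(X_e,X_{s_i})\ge(2r-1)H(X_e)$. -/

import Mathlib

open MeasureTheory ProbabilityTheory Finset
open scoped BigOperators Pointwise

/-- The left translation action of a group `Γ` on configurations indexed by `Γ`: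
`(g · z)(v) = z(g⁻¹ v)`. -/
def shift {Γ A : Type*} [Group Γ] (g : Γ) (z : Γ → A) : Γ → A :=
  fun v => z (g⁻¹ * v)

/-- `X = (X_γ)_{γ ∈ Γ}` is a `Γ`-factor-of-IID process with state space `M`: there are independent
seeds `Z_γ`, each uniformly distributed on `[0,1]`, and a measurable `Γ`-equivariant map
`F : [0,1]^Γ → M^Γ` (product σ-algebras) such that `X = F(Z)` almost surely. -/
def IsFactorOfIID {Γ Ω M : Type*} [Group Γ] [MeasurableSpace Ω] [MeasurableSpace M]
    (P : Measure Ω) (X : Γ → Ω → M) : Prop :=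
  ∃ (Z : Γ → Ω → unitInterval) (F : (Γ → unitInterval) → (Γ → M)),
    (∀ γ, Measurable (Z γ)) ∧
    (∀ γ, Measure.map (Z γ) P = (volume : Measure unitInterval)) ∧
    iIndepFun Z P ∧
    Measurable F ∧
    (∀ g z, F (shift g z) = shift g (F z)) ∧
    (∀ᵐ ω ∂P, ∀ γ, X γ ω = F (fun v => Z v ω) γ)

/-- Shannon entropy (natural logarithm) of a random variable with finitely many values:
`H(Y) = - ∑ₐ ℙ(Y = a) log ℙ(Y = a)`. -/
noncomputable def entropy {Ω A : Type*} [MeasurableSpace Ω] [Fintype A]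
    (P : Measure Ω) (Y : Ω → A) : ℝ :=
  ∑ a, Real.negMulLog (P.real (Y ⁻¹' {a}))

/-- The joint entropy `H(Y, Y')`: the entropy of the pair `(Y, Y')`. -/
noncomputable def entropyPair {Ω A B : Type*} [MeasurableSpace Ω] [Fintype A] [Fintype B]
    (P : Measure Ω) (Y : Ω → A) (Y' : Ω → B) : ℝ :=
  entropy P (fun ω => (Y ω, Y' ω))

/-- The weighted expansion constant: the infimum of `(∑_{σ ∈ S} α_σ |W ∪ σW|) / |W|` over all
nonempty finite subsets `W` of `Γ`. -/
noncomputable def expansion {Γ : Type*} [Group Γ] [DecidableEq Γ]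
    (S : Finset Γ) (α : Γ → ℝ) : ℝ :=
  ⨅ W : {W : Finset Γ // W.Nonempty},
    (∑ σ ∈ S, α σ * ((W.1 ∪ σ • W.1).card : ℝ)) / (W.1.card : ℝ)

/-- The ball of radius `n` around the identity for the word metric of `s₁, …, s_r`: all products
of `n` factors, each of which is `1`, some `sᵢ`, or some `sᵢ⁻¹`. -/
def wordBall {Γ : Type*} [Group Γ] [DecidableEq Γ] {r : ℕ} (s : Fin r → Γ) (n : ℕ) : Finset Γ :=
  ({1} ∪ univ.image s ∪ univ.image (fun i => (s i)⁻¹)) ^ n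

/-- The process `γ ↦ (X_{γ b})_{b ∈ B}` of patterns seen by `X` in the translates `γB`. -/
def blockProcess {Γ Ω M : Type*} [Group Γ] (B : Finset Γ) (X : Γ → Ω → M) :
    Γ → Ω → (B → M) :=
  fun γ ω b => X (γ * b) ω

/-- The quantity `F = (1 - 2r) H(Y_e) + ∑ᵢ H(Y_e, Y_{sᵢ})` of a finite-valued process `Y` over a
free group with free generators `s₁, …, s_r`. -/
noncomputable def bowenF {Γ Ω A : Type*} [Group Γ] [MeasurableSpace Ω] [Fintype A] {r : ℕ}
    (P : Measure Ω) (s : Fin r → Γ) (Y : Γ → Ω → A) : ℝ :=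
  (1 - 2 * (r : ℝ)) * entropy P (Y 1) + ∑ i, entropyPair P (Y 1) (Y (s i))

/-- Bowen's `f`-invariant of a finite-valued process `X` over a free group with free generators
`s₁, …, s_r`: the infimum over `n` of the quantity `F` of the process of `n`-ball patterns of `X`.
It is taken in the extended reals, so that it is `-∞` if these quantities are unbounded below. -/
noncomputable def bowenFInvariant {Γ Ω M : Type*} [Group Γ] [DecidableEq Γ] [MeasurableSpace Ω]
    [Fintype M] {r : ℕ} (P : Measure Ω) (s : Fin r → Γ) (X : Γ → Ω → M) : EReal :=
  ⨅ n : ℕ, ((bowenF P s (blockProcess (wordBall s n) X) : ℝ) : EReal)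

/-! Suppose that Y = X_e is a function of finitely many independent finite-valued seeds ζ_v. Reveal
the seeds in uniformly random order and credit v with the expected drop in the conditional entropy
of Y. This credit w(v) is the Shapley value of v in the game U ↦ -H(Y | ζ_U); the credits are
nonnegative and add up to H(Y). By independence, seeds on which Y does not depend are dummy players,
so w(v) does not change when further seeds join. In the game of the pair (Y, X_σ) the credit of v is
at least its credit for Y and at least its credit for X_σ, which by stationarity is w(σ⁻¹v). Hence
H(Y, X_σ) ≥ ∑_v max(w(v), w(σ⁻¹v)).

If w is the indicator of W, this last sum is |W ∪ σW|, and the definition of β applies; cutting w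
into superlevel sets reduces the general case to this one (`mul_sum_le_sum_mul_sum_max`). This
settles block factors (`entropy_inequality_of_block`). Every factor of IID is a limit in probability
of block factors, and entropy on a finite alphabet is continuous.

For (b), a finite subset W of a free group spans a forest in the Cayley graph, so it has at most |W|
edges and ∑ᵢ |W ∪ sᵢW| ≥ (2r-1)|W|. The inequality with unit weights then applies to each block
process, which is again a factor of IID. -/

/-! ### Shapley values of finite games -/

section Shapley

variable {ι : Type*} [DecidableEq ι]

/-- The probability that a uniformly random order of `m + 1` players puts a given set of `k` players
before a given further player, and the remaining `m - k` players after it. -/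
noncomputable def shapleyWeight (m k : ℕ) : ℝ :=
  ((k.factorial : ℝ) * ((m - k).factorial : ℝ)) / ((m + 1).factorial : ℝ)

/-- The Shapley value of the player `v` in the game `f` with set of players `V ∪ {v}`. -/
noncomputable def shapley (f : Finset ι → ℝ) (V : Finset ι) (v : ι) : ℝ :=
  ∑ U ∈ (V.erase v).powerset,
    shapleyWeight (V.erase v).card U.card * (f (insert v U) - f U)

theorem shapleyWeight_nonneg (m k : ℕ) : 0 ≤ shapleyWeight m k := by
  unfold shapleyWeight; positivity

/-- An additional player comes either after or before the distinguished one; the two terms are these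
cases. -/
theorem shapleyWeight_succ_add {m k : ℕ} (h : k ≤ m) :
    shapleyWeight (m + 1) k + shapleyWeight (m + 1) (k + 1) = shapleyWeight m k := by
  obtain ⟨j, rfl⟩ := Nat.exists_eq_add_of_le h
  unfold shapleyWeight
  have h1 : k + j + 1 - k = j + 1 := by omega
  have h2 : k + j + 1 - (k + 1) = j := by omega
  have h3 : k + j - k = j := by omega
  rw [h1, h2, h3, Nat.factorial_succ (k + j + 1), Nat.factorial_succ k, Nat.factorial_succ j]
  have := Nat.factorial_pos (k + j + 1)
  push_cast
  field_simp
  ring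

theorem shapley_mono {f g : Finset ι → ℝ} {V : Finset ι} {v : ι}
    (h : ∀ U, f (insert v U) - f U ≤ g (insert v U) - g U) : shapley f V v ≤ shapley g V v :=
  Finset.sum_le_sum fun U _ => mul_le_mul_of_nonneg_left (h U) (shapleyWeight_nonneg _ _)

theorem shapley_nonneg {f : Finset ι → ℝ} {V : Finset ι} {v : ι}
    (h : ∀ U, f U ≤ f (insert v U)) : 0 ≤ shapley f V v :=
  Finset.sum_nonneg fun U _ => mul_nonneg (shapleyWeight_nonneg _ _) (sub_nonneg.2 (h U))

theorem shapley_eq_zero_of_dummy {f : Finset ι → ℝ} {V : Finset ι} {v : ι}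
    (h : ∀ U, f (insert v U) = f U) : shapley f V v = 0 :=
  Finset.sum_eq_zero fun U _ => by rw [h U, sub_self, mul_zero]

theorem shapley_insert_of_dummy {f : Finset ι → ℝ} {d : ι} (h : ∀ U, f (insert d U) = f U)
    (V : Finset ι) (v : ι) : shapley f (insert d V) v = shapley f V v := by
  by_cases hdV : d ∈ V
  · rw [Finset.insert_eq_of_mem hdV]
  rcases eq_or_ne d v with rfl | hdv
  · rw [shapley_eq_zero_of_dummy h, shapley_eq_zero_of_dummy h]
  have hd : d ∉ V.erase v := fun h' => hdV (Finset.mem_of_mem_erase h')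
  unfold shapley
  rw [Finset.erase_insert_of_ne hdv, Finset.sum_powerset_insert hd, ← Finset.sum_add_distrib,
    Finset.card_insert_of_notMem hd]
  refine Finset.sum_congr rfl fun U hU => ?_
  have hUV := Finset.mem_powerset.1 hU
  rw [Finset.card_insert_of_notMem (fun h' => hd (hUV h')), Finset.insert_comm, h, h, ← add_mul,
    shapleyWeight_succ_add (Finset.card_le_card hUV)]

/-- Dummies can be removed one at a time. This lets games supported on D and on gD be compared
inside the common player set D ∪ gD. -/
theorem shapley_eq_of_subset {f : Finset ι → ℝ} {D V : Finset ι} (hDV : D ⊆ V)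
    (h : ∀ d ∉ D, ∀ U, f (insert d U) = f U) (v : ι) : shapley f V v = shapley f D v := by
  have key : ∀ E : Finset ι, (∀ d ∈ E, d ∉ D) → shapley f (E ∪ D) v = shapley f D v := by
    intro E
    induction E using Finset.induction_on with
    | empty => simp
    | insert a s _ ih =>
      intro hE
      rw [Finset.insert_union, shapley_insert_of_dummy (h a (hE a (Finset.mem_insert_self _ _))),
        ih fun d hd => hE d (Finset.mem_insert_of_mem hd)]
  have := key (V \ D) fun d hd => (Finset.mem_sdiff.1 hd).2
  rwa [Finset.sdiff_union_of_subset hDV] at this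

theorem shapley_map (e : ι ≃ ι) {f g : Finset ι → ℝ}
    (h : ∀ U : Finset ι, g (U.map e.toEmbedding) = f U) (V : Finset ι) (v : ι) :
    shapley g (V.map e.toEmbedding) (e v) = shapley f V v := by
  have he : (V.map e.toEmbedding).erase (e v) = (V.erase v).map e.toEmbedding := by
    rw [Finset.map_erase]; rfl
  unfold shapley
  rw [he, Finset.card_map]
  symm
  refine Finset.sum_nbij' (fun U => U.map e.toEmbedding) (fun U => U.map e.symm.toEmbedding)
    ?_ ?_ ?_ ?_ ?_
  · intro U hU
    exact Finset.mem_powerset.2 (Finset.map_subset_map.2 (Finset.mem_powerset.1 hU))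
  · intro U hU
    rw [Finset.mem_powerset] at hU ⊢
    intro x hx
    obtain ⟨y, hy, rfl⟩ := Finset.mem_map.1 hx
    obtain ⟨z, hz, hzy⟩ := Finset.mem_map.1 (hU hy)
    rw [← hzy]
    simpa using hz
  · intro U _; ext x; simp
  · intro U _; ext x; simp
  · intro U _
    have hi : insert (e v) (U.map e.toEmbedding) = (insert v U).map e.toEmbedding := by
      rw [Finset.map_insert]; rfl
    simp only [hi, h, Finset.card_map]

/-- Efficiency: along each order of the players the marginal contributions telescope. The proof
compares the coefficients of each f U instead. -/
theorem sum_shapley (f : Finset ι → ℝ) (V : Finset ι) :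
    ∑ v ∈ V, shapley f V v = f V - f ∅ := by
  rcases V.eq_empty_or_nonempty with rfl | hV
  · simp
  obtain ⟨m, hm⟩ : ∃ m, V.card = m + 1 := Nat.exists_eq_succ_of_ne_zero hV.card_pos.ne'
  -- This is 1 / (m+1 choose k), the probability that U, of size k, is an initial segment of the
  -- order. It is the coefficient of f U in both sums below, except that U = ∅ is missing from the
  -- first and U = V from the second.
  set d : ℕ → ℝ := fun k => ((k.factorial : ℝ) * ((m + 1 - k).factorial : ℝ)) /
    ((m + 1).factorial : ℝ) with hd
  have hpos : ((m + 1).factorial : ℝ) ≠ 0 := by positivity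
  have hd0 : d 0 = 1 := by simp [hd, hpos]
  have hdn : d (m + 1) = 1 := by simp [hd, hpos]
  have split : ∑ v ∈ V, shapley f V v =
      ∑ U ∈ V.powerset, (U.card : ℝ) * (shapleyWeight m (U.card - 1) * f U) -
      ∑ U ∈ V.powerset, ((V \ U).card : ℝ) * (shapleyWeight m U.card * f U) := by
    have e1 : ∀ v ∈ V, shapley f V v =
        ∑ U ∈ V.powerset.filter (v ∈ ·), shapleyWeight m (U.card - 1) * f U -
        ∑ U ∈ (V.erase v).powerset, shapleyWeight m U.card * f U := by
      intro v hv
      have hc : (V.erase v).card = m := by rw [Finset.card_erase_of_mem hv, hm]; rfl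
      unfold shapley
      rw [hc]
      simp_rw [mul_sub]
      rw [Finset.sum_sub_distrib]
      congr 1
      refine Finset.sum_nbij' (fun U => insert v U) (fun U => U.erase v) ?_ ?_ ?_ ?_ ?_
      · intro U hU
        rw [Finset.mem_powerset] at hU
        rw [Finset.mem_filter, Finset.mem_powerset]
        exact ⟨Finset.insert_subset hv (hU.trans (Finset.erase_subset _ _)),
          Finset.mem_insert_self _ _⟩
      · intro U hU
        rw [Finset.mem_filter, Finset.mem_powerset] at hU
        exact Finset.mem_powerset.2 (Finset.erase_subset_erase _ hU.1)
      · intro U hU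
        rw [Finset.mem_powerset] at hU
        exact Finset.erase_insert fun h => by simpa using hU h
      · intro U hU
        exact Finset.insert_erase (Finset.mem_filter.1 hU).2
      · intro U hU
        rw [Finset.mem_powerset] at hU
        rw [Finset.card_insert_of_notMem fun h => by simpa using hU h, Nat.add_sub_cancel]
    rw [Finset.sum_congr rfl e1, Finset.sum_sub_distrib]
    congr 1
    · rw [Finset.sum_comm' (s := V) (t' := V.powerset) (s' := fun U => U)]
      · simp
      · intro v U
        simp only [Finset.mem_filter, Finset.mem_powerset]
        exact ⟨fun h => ⟨h.2.2, h.2.1⟩, fun h => ⟨h.2 h.1, h.2, h.1⟩⟩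
    · rw [Finset.sum_comm' (s := V) (t' := V.powerset) (s' := fun U => V \ U)]
      · simp
      · intro v U
        simp only [Finset.mem_sdiff, Finset.mem_powerset, Finset.subset_erase]
        tauto
  have c1 : ∀ U ∈ V.powerset, (U.card : ℝ) * (shapleyWeight m (U.card - 1) * f U) =
      d U.card * f U - if U = ∅ then f U else 0 := by
    intro U hU
    split_ifs with h
    · subst h; simp [hd0]
    · obtain ⟨k, hk⟩ : ∃ k, U.card = k + 1 :=
        Nat.exists_eq_succ_of_ne_zero (Finset.card_ne_zero.2 (Finset.nonempty_iff_ne_empty.2 h))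
      have : m + 1 - (k + 1) = m - k := by omega
      simp only [hk, hd, shapleyWeight, Nat.add_sub_cancel, Nat.factorial_succ k, this]
      push_cast
      ring
  have c2 : ∀ U ∈ V.powerset, ((V \ U).card : ℝ) * (shapleyWeight m U.card * f U) =
      d U.card * f U - if U = V then f U else 0 := by
    intro U hU
    split_ifs with h
    · subst h; simp [hm, hdn]
    · have hUV := Finset.mem_powerset.1 hU
      have hlt : U.card < m + 1 := hm ▸ Finset.card_lt_card (hUV.ssubset_of_ne h)
      obtain ⟨j, hj⟩ : ∃ j, m = U.card + j := Nat.exists_eq_add_of_le (Nat.lt_succ_iff.1 hlt)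
      have hc : (V \ U).card = j + 1 := by rw [Finset.card_sdiff_of_subset hUV]; omega
      have h1 : m + 1 - U.card = j + 1 := by omega
      have h2 : m - U.card = j := by omega
      simp only [hc, hd, shapleyWeight, h1, h2, Nat.factorial_succ j]
      push_cast
      ring
  rw [split, Finset.sum_congr rfl c1, Finset.sum_congr rfl c2, Finset.sum_sub_distrib,
    Finset.sum_sub_distrib]
  simp

end Shapley

/-! ### From sets to nonnegative weights -/

section LayerCake

variable {Γ ι : Type*} [Group Γ] [DecidableEq Γ]

/-- Peel off the lowest layer: subtract the least positive value c on the support S. The left side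
loses βc|S| and the i-th sum loses c|S ∪ σᵢS|, so `hβ` at S pays for the layer, and the support has
shrunk. -/
theorem mul_sum_le_sum_mul_sum_max {T : Finset ι} {σ : ι → Γ} {α : ι → ℝ} {β : ℝ}
    (hβ : ∀ W : Finset Γ, β * (W.card : ℝ) ≤ ∑ i ∈ T, α i * ((W ∪ σ i • W).card : ℝ))
    (D : Finset Γ) (w : Γ → ℝ) (hw : ∀ v, 0 ≤ w v) (hD : ∀ v ∉ D, w v = 0) :
    β * ∑ v ∈ D, w v ≤
      ∑ i ∈ T, α i * ∑ v ∈ D ∪ σ i • D, max (w v) (w ((σ i)⁻¹ * v)) := by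
  induction hn : (D.filter (fun v => w v ≠ 0)).card using Nat.strong_induction_on generalizing w with
  | _ n ih =>
  subst hn
  set S := D.filter (fun v => w v ≠ 0) with hS
  have hmem : ∀ v, v ∈ S ↔ w v ≠ 0 := fun v => by
    rw [hS, Finset.mem_filter]
    exact ⟨fun h => h.2, fun h => ⟨by_contra fun h' => h (hD v h'), h⟩⟩
  have hSD : S ⊆ D := Finset.filter_subset _ _
  rcases S.eq_empty_or_nonempty with hE | hne
  · have h0 : ∀ v, w v = 0 := fun v => by
      by_contra h
      have := (hmem v).2 h
      simp [hE] at this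
    simp [h0]
  obtain ⟨a, haS, ha⟩ := Finset.exists_min_image S w hne
  set c := w a
  have hc : 0 < c := lt_of_le_of_ne (hw a) (Ne.symm ((hmem a).1 haS))
  set w' : Γ → ℝ := fun v => if v ∈ S then w v - c else 0 with hw'
  have hw'0 : ∀ v, 0 ≤ w' v := fun v => by
    simp only [hw']; split_ifs with h
    · exact sub_nonneg.2 (ha v h)
    · exact le_rfl
  have hwe : ∀ v, w v = w' v + if v ∈ S then c else 0 := fun v => by
    simp only [hw']; split_ifs with h
    · ring
    · rw [add_zero]; by_contra h'; exact h ((hmem v).2 h')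
  have hlt : (D.filter (fun v => w' v ≠ 0)).card < S.card := by
    refine Finset.card_lt_card ⟨fun v hv => ?_, fun h => ?_⟩
    · by_contra h
      exact (Finset.mem_filter.1 hv).2 (by simp [hw', h])
    · have := (Finset.mem_filter.1 (h haS)).2
      simp [hw', haS, c] at this
  have IH := ih _ hlt w' hw'0 (fun v hv => by
    have : v ∉ S := fun h => hv (hSD h)
    simp [hw', this]) rfl
  have hsum : ∑ v ∈ D, w v = ∑ v ∈ D, w' v + c * S.card := by
    rw [Finset.sum_congr rfl fun v _ => hwe v, Finset.sum_add_distrib,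
      Finset.sum_ite_mem D S fun _ => c, Finset.sum_const, nsmul_eq_mul, Finset.inter_eq_right.2 hSD,
      mul_comm c]
  have hmax : ∀ i, ∑ v ∈ D ∪ σ i • D, max (w v) (w ((σ i)⁻¹ * v)) =
      ∑ v ∈ D ∪ σ i • D, max (w' v) (w' ((σ i)⁻¹ * v)) + c * ((S ∪ σ i • S).card : ℝ) := by
    intro i
    have hpt : ∀ v, max (w v) (w ((σ i)⁻¹ * v)) =
        max (w' v) (w' ((σ i)⁻¹ * v)) + if v ∈ S ∪ σ i • S then c else 0 := by
      intro v
      have hm : v ∈ σ i • S ↔ (σ i)⁻¹ * v ∈ S := by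
        rw [← Finset.inv_smul_mem_iff, smul_eq_mul]
      rw [hwe v, hwe ((σ i)⁻¹ * v)]
      simp only [Finset.mem_union, hm]
      by_cases h1 : v ∈ S <;> by_cases h2 : (σ i)⁻¹ * v ∈ S
      · simp [h1, h2, max_add_add_right]
      · have : w' ((σ i)⁻¹ * v) = 0 := by simp [hw', h2]
        simp only [h1, h2, this, if_true, if_false, true_or, add_zero]
        rw [max_eq_left (hw'0 v), max_eq_left (by linarith [hw'0 v])]
      · have : w' v = 0 := by simp [hw', h1]
        simp only [h1, h2, this, if_true, if_false, or_true, add_zero]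
        rw [max_eq_right (hw'0 _), max_eq_right (by linarith [hw'0 ((σ i)⁻¹ * v)])]
      · simp [h1, h2]
    rw [Finset.sum_congr rfl fun v _ => hpt v, Finset.sum_add_distrib, Finset.sum_ite_mem,
      Finset.sum_const, nsmul_eq_mul, Finset.inter_eq_right.2
        (Finset.union_subset_union hSD (Finset.smul_finset_subset_smul_finset hSD)), mul_comm c]
  rw [hsum]
  simp_rw [hmax, mul_add, Finset.sum_add_distrib]
  have h1 := mul_le_mul_of_nonneg_left (hβ S) hc.le
  have h2 : ∑ i ∈ T, α i * (c * ((S ∪ σ i • S).card : ℝ)) =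
      c * ∑ i ∈ T, α i * ((S ∪ σ i • S).card : ℝ) := by
    rw [Finset.mul_sum]; exact Finset.sum_congr rfl fun i _ => by ring
  rw [h2]
  nlinarith

end LayerCake

/-! ### Expansion in free groups -/

section Forest

/-- No cancellation occurs unless the reduced word starts with the generator i. -/
theorem FreeGroup.head?_toWord_inv_of_mul {α : Type*} [DecidableEq α] (i : α) (x : FreeGroup α)
    (h : x.toWord.head? ≠ some (i, true)) :
    ((FreeGroup.of i)⁻¹ * x).toWord.head? = some (i, false) := by
  have h1 : ((FreeGroup.of i)⁻¹ : FreeGroup α).toWord = [(i, false)] := by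
    simp [FreeGroup.toWord_inv, FreeGroup.invRev]
  rw [FreeGroup.toWord_mul, h1, List.singleton_append, FreeGroup.reduce.cons,
    FreeGroup.reduce_toWord]
  cases hx : x.toWord with
  | nil => rfl
  | cons a l =>
    rw [hx] at h
    obtain ⟨j, b⟩ := a
    have : ¬ (i = j ∧ false = !b) := by
      rintro ⟨rfl, hb⟩
      cases b
      · exact absurd hb (by decide)
      · exact h rfl
    simp only [this, if_false, List.head?_cons]

variable {Γ : Type*} [Group Γ] [DecidableEq Γ]

/-- A pair (i, u) on the left is an edge between u and sᵢ⁻¹u inside W. Send it to its endpoint with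
the longer reduced word: the first letter of that word determines the edge, so the map is injective.
-/
theorem FreeGroupBasis.sum_card_inter_smul_le {ι : Type*} [Fintype ι] [DecidableEq ι]
    (s : FreeGroupBasis ι Γ) (W : Finset Γ) :
    ∑ i, (W ∩ s i • W).card ≤ W.card := by
  rw [← Finset.card_sigma]
  let hd : Γ → Option (ι × Bool) := fun u => (s.repr u).toWord.head?
  have hhd : ∀ i u, hd u ≠ some (i, true) → hd ((s i)⁻¹ * u) = some (i, false) := by
    intro i u h
    have := FreeGroup.head?_toWord_inv_of_mul i (s.repr u) h
    simpa [hd] using this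
  refine Finset.card_le_card_of_injOn
    (fun p => if hd p.2 = some (p.1, true) then p.2 else (s p.1)⁻¹ * p.2) ?_ ?_
  · rintro ⟨i, u⟩ hp
    simp only [Finset.coe_sigma, Set.mem_sigma_iff, Finset.mem_coe, Finset.mem_inter] at hp
    dsimp only
    split_ifs
    · exact hp.2.1
    · have := Finset.inv_smul_mem_iff.2 hp.2.2
      simpa using this
  · rintro ⟨i, u⟩ _ ⟨j, v⟩ _ h
    dsimp only at h
    split_ifs at h with h1 h2 h2
    · subst h
      rw [h1] at h2
      simp only [Option.some.injEq, Prod.mk.injEq, and_true] at h2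
      subst h2; rfl
    · have := hhd j v h2
      rw [← h, h1] at this; simp at this
    · have := hhd i u h1
      rw [h, h2] at this; simp at this
    · have e1 := hhd i u h1
      rw [h, hhd j v h2] at e1
      simp only [Option.some.injEq, Prod.mk.injEq, and_true] at e1
      subst e1
      rw [mul_left_cancel h]

theorem FreeGroupBasis.mul_card_le_sum_card_union_smul {r : ℕ}
    (s : FreeGroupBasis (Fin r) Γ) (W : Finset Γ) :
    (2 * (r : ℝ) - 1) * (W.card : ℝ) ≤ ∑ i, ((W ∪ s i • W).card : ℝ) := by
  have h1 : ∀ i, ((W ∪ s i • W).card : ℝ) = 2 * W.card - ((W ∩ s i • W).card : ℝ) := by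
    intro i
    have := Finset.card_union_add_card_inter W (s i • W)
    rw [Finset.card_smul_finset] at this
    have h : (((W ∪ s i • W).card + (W ∩ s i • W).card : ℕ) : ℝ) = ((W.card + W.card : ℕ) : ℝ) := by
      rw [this]
    push_cast at h
    linarith
  have h2 : (∑ i, ((W ∩ s i • W).card : ℝ)) ≤ W.card := by
    exact_mod_cast s.sum_card_inter_smul_le W
  rw [Finset.sum_congr rfl fun i _ => h1 i, Finset.sum_sub_distrib, Finset.sum_const]
  simp only [Finset.card_univ, Fintype.card_fin, nsmul_eq_mul]
  linarith

end Forest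

/-! ### Shannon entropy: submodularity, independence, continuity -/

section Entropy

variable {Ω : Type*} [MeasurableSpace Ω] {P : Measure Ω}

theorem preimage_prodMk_singleton {Ω A B : Type*} (X : Ω → A) (Y : Ω → B) (a : A) (b : B) :
    (fun ω => (X ω, Y ω)) ⁻¹' {(a, b)} = X ⁻¹' {a} ∩ Y ⁻¹' {b} := by
  ext ω; simp

/-- Random variables that generate the same partition have the same entropy. -/
theorem entropy_congr_ker {A B : Type*} [Fintype A] [Fintype B] {Y : Ω → A} {Y' : Ω → B}
    (h : ∀ ω ω', Y ω = Y ω' ↔ Y' ω = Y' ω') : entropy P Y = entropy P Y' := by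
  classical
  -- Values that are never attained contribute zero, so matching the attained values suffices.
  have hex : ∀ a, Real.negMulLog (P.real (Y ⁻¹' {a})) ≠ 0 → ∃ ω, Y ω = a := by
    intro a ha
    by_contra! hne
    have : Y ⁻¹' {a} = ∅ := Set.eq_empty_of_forall_notMem fun ω hω => hne ω hω
    simp [this] at ha
  have hpre : ∀ ω, Y ⁻¹' {Y ω} = Y' ⁻¹' {Y' ω} := fun ω => Set.ext fun ω' => h ω' ω
  unfold entropy
  refine Finset.sum_bij_ne_zero (fun a _ ha => Y' (hex a ha).choose) (fun _ _ _ => mem_univ _)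
    ?_ ?_ ?_
  · intro a _ ha b _ hb hab
    have := (h _ _).2 hab
    rwa [(hex a ha).choose_spec, (hex b hb).choose_spec] at this
  · intro b _ hb
    have : ∃ ω, Y' ω = b := by
      by_contra! hne
      have : Y' ⁻¹' {b} = ∅ := Set.eq_empty_of_forall_notMem fun ω hω => hne ω hω
      simp [this] at hb
    obtain ⟨ω, rfl⟩ := this
    rw [← hpre ω] at hb
    exact ⟨Y ω, mem_univ _, hb, (h _ _).1 (hex _ hb).choose_spec⟩
  · intro a _ ha
    conv_lhs => rw [← (hex a ha).choose_spec]
    rw [hpre]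

theorem entropy_congr_ae {A : Type*} [Fintype A] {Y Y' : Ω → A} (h : Y =ᵐ[P] Y') :
    entropy P Y = entropy P Y' := by
  refine Finset.sum_congr rfl fun a _ => ?_
  congr 1
  refine measureReal_congr ?_
  filter_upwards [h] with ω hω
  change (Y ω = a) = (Y' ω = a)
  rw [hω]

theorem entropy_comp_measurePreserving {Ω' : Type*} [MeasurableSpace Ω'] {Q : Measure Ω'}
    {f : Ω → Ω'} (hf : MeasurePreserving f P Q) {A : Type*} [Fintype A] [MeasurableSpace A]
    [MeasurableSingletonClass A] {Y : Ω' → A} (hY : Measurable Y) :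
    entropy P (fun ω => Y (f ω)) = entropy Q Y := by
  refine Finset.sum_congr rfl fun a _ => ?_
  congr 1
  exact hf.measureReal_preimage (hY (measurableSet_singleton a)).nullMeasurableSet

/-- Restricting P to s makes this additivity over the fibres of Z, so s itself may be any set. -/
theorem measureReal_eq_sum_inter [IsFiniteMeasure P] {B : Type*} [Fintype B] [MeasurableSpace B]
    [MeasurableSingletonClass B] {Z : Ω → B} (hZ : Measurable Z) (s : Set Ω) :
    P.real s = ∑ b, P.real (s ∩ Z ⁻¹' {b}) := by
  have h := sum_measureReal_preimage_singleton (μ := P.restrict s) (Finset.univ : Finset B)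
    (f := Z) (fun b _ => hZ (measurableSet_singleton b))
  simp only [Finset.coe_univ, Set.preimage_univ] at h
  rw [measureReal_restrict_apply_univ] at h
  rw [← h]
  refine Finset.sum_congr rfl fun b _ => ?_
  rw [measureReal_restrict_apply (hZ (measurableSet_singleton b)), Set.inter_comm]

/-- Gibbs' inequality: p is compared with q r / s, the distribution with the same marginals q and r
under which the outer variables are conditionally independent given the middle one. It has the same
total mass, so log x ≤ x - 1 gives the claim. -/
theorem sum_negMulLog_submodular {A B C : Type*} [Fintype A] [Fintype B] [Fintype C]
    (p : A → B → C → ℝ) (hp : ∀ a b c, 0 ≤ p a b c) :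
    ∑ a, ∑ b, ∑ c, Real.negMulLog (p a b c) + ∑ b, Real.negMulLog (∑ a, ∑ c, p a b c) ≤
      ∑ a, ∑ b, Real.negMulLog (∑ c, p a b c) + ∑ b, ∑ c, Real.negMulLog (∑ a, p a b c) := by
  set q : A → B → ℝ := fun a b => ∑ c, p a b c with hq
  set r : B → C → ℝ := fun b c => ∑ a, p a b c with hr
  set s : B → ℝ := fun b => ∑ a, ∑ c, p a b c with hs
  have hq0 : ∀ a b, 0 ≤ q a b := fun a b => Finset.sum_nonneg fun c _ => hp a b c
  have hr0 : ∀ b c, 0 ≤ r b c := fun b c => Finset.sum_nonneg fun a _ => hp a b c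
  have hs0 : ∀ b, 0 ≤ s b := fun b => Finset.sum_nonneg fun a _ => hq0 a b
  have hpq : ∀ a b c, p a b c ≤ q a b := fun a b c =>
    Finset.single_le_sum (f := fun c => p a b c) (fun c _ => hp a b c) (mem_univ c)
  have hpr : ∀ a b c, p a b c ≤ r b c := fun a b c =>
    Finset.single_le_sum (f := fun a => p a b c) (fun a _ => hp a b c) (mem_univ a)
  have hqs : ∀ a b, q a b ≤ s b := fun a b =>
    Finset.single_le_sum (f := fun a => q a b) (fun a _ => hq0 a b) (mem_univ a)
  have hs' : ∀ b, s b = ∑ c, r b c := fun b => Finset.sum_comm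
  have key : ∀ a b c, p a b c * (Real.log (q a b) + Real.log (r b c) - Real.log (p a b c)
      - Real.log (s b)) ≤ q a b * r b c / s b - p a b c := by
    intro a b c
    rcases (hp a b c).eq_or_lt with h0 | h0
    · rw [← h0, zero_mul, sub_zero]
      exact div_nonneg (mul_nonneg (hq0 a b) (hr0 b c)) (hs0 b)
    · have hq1 := h0.trans_le (hpq a b c)
      have hr1 := h0.trans_le (hpr a b c)
      have hs1 := hq1.trans_le (hqs a b)
      have e : Real.log (q a b) + Real.log (r b c) - Real.log (p a b c) - Real.log (s b) =
          Real.log (q a b * r b c / (p a b c * s b)) := by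
        rw [Real.log_div (by positivity) (by positivity), Real.log_mul hq1.ne' hr1.ne',
          Real.log_mul h0.ne' hs1.ne']
        ring
      rw [e]
      have := mul_le_mul_of_nonneg_left
        (Real.log_le_sub_one_of_pos (x := q a b * r b c / (p a b c * s b)) (by positivity)) h0.le
      refine this.trans (le_of_eq ?_)
      field_simp
  have hsum := Finset.sum_le_sum fun a (_ : a ∈ (univ : Finset A)) =>
    Finset.sum_le_sum fun b (_ : b ∈ (univ : Finset B)) =>
      Finset.sum_le_sum fun c (_ : c ∈ (univ : Finset C)) => key a b c
  have hzero : ∑ a, ∑ b, ∑ c, (q a b * r b c / s b - p a b c) = 0 := by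
    simp_rw [Finset.sum_sub_distrib]
    rw [sub_eq_zero, Finset.sum_comm, Finset.sum_comm (f := fun a b => ∑ c, p a b c)]
    refine Finset.sum_congr rfl fun b _ => ?_
    change _ = s b
    have : ∀ a, ∑ c, q a b * r b c / s b = q a b * (s b / s b) := fun a => by
      rw [← Finset.sum_div, ← Finset.mul_sum, ← hs', mul_div_assoc]
    rw [Finset.sum_congr rfl fun a _ => this a, ← Finset.sum_mul]
    change s b * (s b / s b) = s b
    -- This also covers s b = 0, where division by zero yields 0.
    rw [← mul_div_assoc, mul_self_div_self]
  rw [hzero] at hsum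
  have e1 : ∑ a, ∑ b, Real.negMulLog (q a b) = -∑ a, ∑ b, ∑ c, p a b c * Real.log (q a b) := by
    simp only [Real.negMulLog, neg_mul, Finset.sum_neg_distrib, ← Finset.sum_mul, hq]
  have e2 : ∑ b, ∑ c, Real.negMulLog (r b c) = -∑ a, ∑ b, ∑ c, p a b c * Real.log (r b c) := by
    rw [Finset.sum_comm (f := fun a b => ∑ c, p a b c * Real.log (r b c)), ← Finset.sum_neg_distrib]
    refine Finset.sum_congr rfl fun b _ => ?_
    rw [Finset.sum_comm]
    simp only [Real.negMulLog, neg_mul, Finset.sum_neg_distrib, ← Finset.sum_mul, hr]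
  have e3 : ∑ b, Real.negMulLog (s b) = -∑ a, ∑ b, ∑ c, p a b c * Real.log (s b) := by
    rw [Finset.sum_comm (f := fun a b => ∑ c, p a b c * Real.log (s b)), ← Finset.sum_neg_distrib]
    simp only [Real.negMulLog, neg_mul, Finset.sum_neg_distrib, ← Finset.sum_mul, hs]
  have e4 : ∑ a, ∑ b, ∑ c, Real.negMulLog (p a b c) =
      -∑ a, ∑ b, ∑ c, p a b c * Real.log (p a b c) := by
    simp only [Real.negMulLog, neg_mul, Finset.sum_neg_distrib]
  change _ + ∑ b, Real.negMulLog (s b) ≤ _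
  rw [e1, e2, e3, e4]
  simp only [mul_sub, mul_add, Finset.sum_sub_distrib, Finset.sum_add_distrib] at hsum
  linarith

variable {A B C : Type*} [Fintype A] [MeasurableSpace A] [MeasurableSingletonClass A]
  [Fintype B] [Fintype C] [MeasurableSpace C] [MeasurableSingletonClass C]

/-- Strong subadditivity of Shannon entropy. -/
theorem entropy_submodular [IsFiniteMeasure P] {X : Ω → A} {Y : Ω → B} {Z : Ω → C}
    (hX : Measurable X) (hZ : Measurable Z) :
    entropy P (fun ω => (X ω, Y ω, Z ω)) + entropy P Y ≤
      entropy P (fun ω => (X ω, Y ω)) + entropy P (fun ω => (Y ω, Z ω)) := by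
  set p : A → B → C → ℝ := fun a b c => P.real (X ⁻¹' {a} ∩ Y ⁻¹' {b} ∩ Z ⁻¹' {c}) with hp
  have h := sum_negMulLog_submodular p fun _ _ _ => measureReal_nonneg
  have e1 : entropy P (fun ω => (X ω, Y ω, Z ω)) = ∑ a, ∑ b, ∑ c, Real.negMulLog (p a b c) := by
    simp only [entropy, Fintype.sum_prod_type]
    refine Finset.sum_congr rfl fun a _ => Finset.sum_congr rfl fun b _ =>
      Finset.sum_congr rfl fun c _ => ?_
    rw [preimage_prodMk_singleton, preimage_prodMk_singleton, ← Set.inter_assoc]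
  have m1 : ∀ a b, ∑ c, p a b c = P.real (X ⁻¹' {a} ∩ Y ⁻¹' {b}) := fun a b =>
    (measureReal_eq_sum_inter hZ _).symm
  have m2 : ∀ b c, ∑ a, p a b c = P.real (Y ⁻¹' {b} ∩ Z ⁻¹' {c}) := fun b c => by
    rw [measureReal_eq_sum_inter hX]
    refine Finset.sum_congr rfl fun a _ => ?_
    rw [Set.inter_comm, ← Set.inter_assoc]
  have m3 : ∀ b, ∑ a, ∑ c, p a b c = P.real (Y ⁻¹' {b}) := fun b => by
    rw [measureReal_eq_sum_inter hX]
    refine Finset.sum_congr rfl fun a _ => ?_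
    rw [m1, Set.inter_comm]
  simp only [m3] at h
  simp only [m1, m2] at h
  rw [e1]
  simpa only [entropy, Fintype.sum_prod_type, preimage_prodMk_singleton] using h

theorem entropy_prod_of_indepFun [MeasurableSpace B] [MeasurableSingletonClass B]
    [IsProbabilityMeasure P] {X : Ω → A} {Y : Ω → B}
    (hX : Measurable X) (hY : Measurable Y) (h : IndepFun X Y P) :
    entropy P (fun ω => (X ω, Y ω)) = entropy P X + entropy P Y := by
  have hprod : ∀ a b, P.real ((fun ω => (X ω, Y ω)) ⁻¹' {(a, b)}) =
      P.real (X ⁻¹' {a}) * P.real (Y ⁻¹' {b}) := by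
    intro a b
    have := h.measure_inter_preimage_eq_mul _ _ (measurableSet_singleton a)
      (measurableSet_singleton b)
    rw [preimage_prodMk_singleton, measureReal_def, this, ENNReal.toReal_mul]
    rfl
  have hX1 : ∑ a, P.real (X ⁻¹' {a}) = 1 := by
    have := measureReal_eq_sum_inter (P := P) hX Set.univ
    simpa using this.symm
  have hY1 : ∑ b, P.real (Y ⁻¹' {b}) = 1 := by
    have := measureReal_eq_sum_inter (P := P) hY Set.univ
    simpa using this.symm
  simp only [entropy, Fintype.sum_prod_type, hprod, Real.negMulLog_mul, Finset.sum_add_distrib]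
  simp only [← Finset.sum_mul, ← Finset.mul_sum, hX1, hY1, one_mul]

theorem tendsto_entropy [IsFiniteMeasure P] {A : Type*} [Fintype A] {Y : Ω → A} {Yn : ℕ → Ω → A}
    {δ : ℕ → ℝ} (hδ : Filter.Tendsto δ Filter.atTop (nhds 0))
    (h : ∀ n, P.real {ω | Yn n ω ≠ Y ω} ≤ δ n) :
    Filter.Tendsto (fun n => entropy P (Yn n)) Filter.atTop (nhds (entropy P Y)) := by
  refine tendsto_finsetSum _ fun a _ => (Real.continuous_negMulLog.tendsto _).comp ?_
  rw [tendsto_iff_dist_tendsto_zero]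
  refine squeeze_zero (fun _ => dist_nonneg) (fun n => ?_) hδ
  refine le_trans ?_ (h n)
  rw [Real.dist_eq, abs_sub_le_iff, sub_le_iff_le_add, sub_le_iff_le_add]
  constructor
  · refine (measureReal_mono (fun ω hω => ?_)).trans (measureReal_union_le _ _)
    by_cases hne : Yn n ω = Y ω
    · exact Or.inr (by rw [Set.mem_preimage, ← hne]; exact hω)
    · exact Or.inl hne
  · refine (measureReal_mono (fun ω hω => ?_)).trans (measureReal_union_le _ _)
    by_cases hne : Yn n ω = Y ω
    · exact Or.inr (by rw [Set.mem_preimage, hne]; exact hω)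
    · exact Or.inl hne

end Entropy

set_option linter.unusedSectionVars false

/-! ### The conditional entropy game -/

section Game

variable {Γ Ω K A B : Type*} [DecidableEq Γ] [MeasurableSpace Ω] {P : Measure Ω}
  [Fintype K] [MeasurableSpace K] [MeasurableSingletonClass K]
  [Fintype A] [MeasurableSpace A] [MeasurableSingletonClass A]
  [Fintype B] [MeasurableSpace B] [MeasurableSingletonClass B]

/-- The restriction of the family of random variables `ζ` to the index set `U`. -/
def jointVar (ζ : Γ → Ω → K) (U : Finset Γ) : Ω → (U → K) :=
  fun ω u => ζ u ω

theorem jointVar_eq_iff {ζ : Γ → Ω → K} {U : Finset Γ} {ω ω' : Ω} :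
    jointVar ζ U ω = jointVar ζ U ω' ↔ ∀ u ∈ U, ζ u ω = ζ u ω' := by
  simp [jointVar, funext_iff]

theorem measurable_jointVar {ζ : Γ → Ω → K} (hζ : ∀ v, Measurable (ζ v)) (U : Finset Γ) :
    Measurable (jointVar ζ U) :=
  measurable_pi_lambda _ fun u => hζ u

/-- Minus the conditional entropy of `Y` given the variables `ζ_u`, `u ∈ U`, as a function
of `U`. -/
noncomputable def entropyGame (P : Measure Ω) (ζ : Γ → Ω → K) (Y : Ω → A) (U : Finset Γ) : ℝ :=
  entropy P (jointVar ζ U) - entropy P (fun ω => (Y ω, jointVar ζ U ω))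

/-- The difference of the two sides is the conditional mutual information of Y and ζ_v given W and
ζ_U. Constant W gives monotonicity of the game; W equal to one member of a pair shows that marginal
contributions grow when the other member is added. -/
theorem entropy_sub_le_insert [IsFiniteMeasure P] {ζ : Γ → Ω → K} (hζ : ∀ v, Measurable (ζ v))
    (W : Ω → A) {Y : Ω → B} (hY : Measurable Y) (v : Γ) (U : Finset Γ) :
    entropy P (fun ω => (W ω, jointVar ζ U ω)) -
        entropy P (fun ω => ((W ω, Y ω), jointVar ζ U ω)) ≤
      entropy P (fun ω => (W ω, jointVar ζ (insert v U) ω)) -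
        entropy P (fun ω => ((W ω, Y ω), jointVar ζ (insert v U) ω)) := by
  have h := entropy_submodular (P := P) (Y := fun ω => (W ω, jointVar ζ U ω)) hY (hζ v)
  have e1 : entropy P (fun ω => (Y ω, (W ω, jointVar ζ U ω), ζ v ω)) =
      entropy P (fun ω => ((W ω, Y ω), jointVar ζ (insert v U) ω)) :=
    entropy_congr_ker fun ω ω' => by
      simp only [Prod.mk.injEq, jointVar_eq_iff, Finset.forall_mem_insert]; tauto
  have e2 : entropy P (fun ω => (Y ω, (W ω, jointVar ζ U ω))) =
      entropy P (fun ω => ((W ω, Y ω), jointVar ζ U ω)) :=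
    entropy_congr_ker fun ω ω' => by
      simp only [Prod.mk.injEq]; tauto
  have e3 : entropy P (fun ω => ((W ω, jointVar ζ U ω), ζ v ω)) =
      entropy P (fun ω => (W ω, jointVar ζ (insert v U) ω)) :=
    entropy_congr_ker fun ω ω' => by
      simp only [Prod.mk.injEq, jointVar_eq_iff, Finset.forall_mem_insert]; tauto
  rw [e1, e2, e3] at h
  linarith

theorem entropyGame_le_insert [IsFiniteMeasure P] {ζ : Γ → Ω → K} (hζ : ∀ v, Measurable (ζ v))
    {Y : Ω → A} (hY : Measurable Y) (v : Γ) (U : Finset Γ) :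
    entropyGame P ζ Y U ≤ entropyGame P ζ Y (insert v U) := by
  have h := entropy_sub_le_insert (P := P) hζ (fun _ => ()) hY v U
  have e1 : ∀ U : Finset Γ, entropy P (fun ω => ((), jointVar ζ U ω)) =
      entropy P (jointVar ζ U) := fun U =>
    entropy_congr_ker fun ω ω' => by simp only [Prod.mk.injEq, true_and]
  have e2 : ∀ U : Finset Γ, entropy P (fun ω => (((), Y ω), jointVar ζ U ω)) =
      entropy P (fun ω => (Y ω, jointVar ζ U ω)) := fun U =>
    entropy_congr_ker fun ω ω' => by simp only [Prod.mk.injEq, true_and]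
  simpa only [entropyGame, e1, e2] using h

theorem entropyGame_marginal_le_prod [IsFiniteMeasure P] {ζ : Γ → Ω → K}
    (hζ : ∀ v, Measurable (ζ v)) (Y : Ω → A) {Y' : Ω → B} (hY' : Measurable Y')
    (v : Γ) (U : Finset Γ) :
    entropyGame P ζ Y (insert v U) - entropyGame P ζ Y U ≤
      entropyGame P ζ (fun ω => (Y ω, Y' ω)) (insert v U) -
        entropyGame P ζ (fun ω => (Y ω, Y' ω)) U := by
  have h := entropy_sub_le_insert (P := P) hζ Y hY' v U
  unfold entropyGame
  linarith

theorem entropyGame_prod_swap (ζ : Γ → Ω → K) (Y : Ω → A) (Y' : Ω → B) :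
    entropyGame P ζ (fun ω => (Y ω, Y' ω)) = entropyGame P ζ (fun ω => (Y' ω, Y ω)) := by
  funext U
  unfold entropyGame
  congr 1
  exact entropy_congr_ker fun ω ω' => by simp only [Prod.mk.injEq]; tauto

/-- For d outside both D and U, ζ_d is independent of (Y, ζ_U), so both entropies in the game grow
by H(ζ_d). -/
theorem entropyGame_insert_of_notMem [IsProbabilityMeasure P] {ζ : Γ → Ω → K}
    (hζ : ∀ v, Measurable (ζ v)) (hind : iIndepFun ζ P) {Y : Ω → A} {D : Finset Γ}
    (hY : ∃ φ : (D → K) → A, ∀ ω, Y ω = φ (jointVar ζ D ω)) {d : Γ} (hd : d ∉ D)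
    (U : Finset Γ) : entropyGame P ζ Y (insert d U) = entropyGame P ζ Y U := by
  by_cases hdU : d ∈ U
  · rw [Finset.insert_eq_of_mem hdU]
  obtain ⟨φ, hφ⟩ := hY
  have hYm : Measurable Y := by
    rw [show Y = φ ∘ jointVar ζ D from funext hφ]
    exact (Measurable.of_discrete).comp (measurable_jointVar hζ D)
  have hdisj : Disjoint {d} (U ∪ D) := by
    rw [Finset.disjoint_singleton_left, Finset.mem_union]; tauto
  have h0 := hind.indepFun_finset {d} (U ∪ D) hdisj hζ
  have h1 : IndepFun (ζ d) (fun ω => (Y ω, jointVar ζ U ω)) P := by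
    have := h0.comp (φ := fun k : (({d} : Finset Γ) → K) => k ⟨d, Finset.mem_singleton_self d⟩)
      (ψ := fun k : ((U ∪ D : Finset Γ) → K) =>
        (φ fun u => k ⟨u, Finset.mem_union_right _ u.2⟩,
          fun u : U => k ⟨u, Finset.mem_union_left _ u.2⟩)) Measurable.of_discrete
      Measurable.of_discrete
    obtain rfl : Y = fun ω => φ (jointVar ζ D ω) := funext hφ
    exact this
  have h2 : IndepFun (ζ d) (jointVar ζ U) P := h1.comp measurable_id measurable_snd
  have e1 := entropy_prod_of_indepFun (hζ d) (hYm.prodMk (measurable_jointVar hζ U)) h1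
  have e2 := entropy_prod_of_indepFun (hζ d) (measurable_jointVar hζ U) h2
  have e3 : entropy P (jointVar ζ (insert d U)) = entropy P (fun ω => (ζ d ω, jointVar ζ U ω)) :=
    entropy_congr_ker fun ω ω' => by
      simp only [Prod.mk.injEq, jointVar_eq_iff, Finset.forall_mem_insert]
  have e4 : entropy P (fun ω => (Y ω, jointVar ζ (insert d U) ω)) =
      entropy P (fun ω => (ζ d ω, Y ω, jointVar ζ U ω)) :=
    entropy_congr_ker fun ω ω' => by
      simp only [Prod.mk.injEq, jointVar_eq_iff, Finset.forall_mem_insert]; tauto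
  unfold entropyGame
  rw [e3, e4, e1, e2]
  ring

theorem sum_shapley_entropyGame [IsProbabilityMeasure P] {ζ : Γ → Ω → K} {Y : Ω → A}
    {V : Finset Γ} (hY : ∀ ω ω', jointVar ζ V ω = jointVar ζ V ω' → Y ω = Y ω') :
    ∑ v ∈ V, shapley (entropyGame P ζ Y) V v = entropy P Y := by
  have e1 : entropy P (fun ω => (Y ω, jointVar ζ V ω)) = entropy P (jointVar ζ V) :=
    entropy_congr_ker fun ω ω' => by
      simp only [Prod.mk.injEq]
      exact ⟨fun h => h.2, fun h => ⟨hY _ _ h, h⟩⟩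
  have e2 : entropy P (fun ω => (Y ω, jointVar ζ (∅ : Finset Γ) ω)) = entropy P Y :=
    entropy_congr_ker fun ω ω' => by simp [jointVar_eq_iff]
  have e3 : entropy P (jointVar ζ (∅ : Finset Γ)) = 0 := by
    rw [entropy_congr_ker (Y' := fun _ : Ω => ()) fun ω ω' => by simp [jointVar_eq_iff]]
    simp [entropy]
  rw [sum_shapley, entropyGame, entropyGame, e1, e2, e3]
  ring

end Game

/-! ### The inequality for block factors -/

section Block

variable {Γ Ω K A : Type*} [Group Γ] [DecidableEq Γ] [MeasurableSpace Ω] {P : Measure Ω}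
  [IsProbabilityMeasure P]
  [Fintype K] [MeasurableSpace K] [MeasurableSingletonClass K]
  [Fintype A] [MeasurableSpace A] [MeasurableSingletonClass A]

theorem entropyGame_translate {ζ : Γ → Ω → K} (hζ : ∀ v, Measurable (ζ v)) {τ : Ω → Ω}
    (hτ : MeasurePreserving τ P P) {g : Γ} (hτζ : ∀ v ω, ζ v (τ ω) = ζ (g * v) ω)
    {Y : Ω → A} (hY : Measurable Y) (U : Finset Γ) :
    entropyGame P ζ (fun ω => Y (τ ω)) (U.map (Equiv.mulLeft g).toEmbedding) =
      entropyGame P ζ Y U := by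
  have hker : ∀ ω ω', jointVar ζ (U.map (Equiv.mulLeft g).toEmbedding) ω =
      jointVar ζ (U.map (Equiv.mulLeft g).toEmbedding) ω' ↔
      jointVar ζ U (τ ω) = jointVar ζ U (τ ω') := by
    intro ω ω'
    simp only [jointVar_eq_iff, hτζ, Finset.forall_mem_map]
    exact Iff.rfl
  unfold entropyGame
  rw [← entropy_comp_measurePreserving hτ (measurable_jointVar hζ U),
    ← entropy_comp_measurePreserving hτ (hY.prodMk (measurable_jointVar hζ U))]
  congr 1
  · exact entropy_congr_ker hker
  · exact entropy_congr_ker fun ω ω' => by simp only [Prod.mk.injEq, hker]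

/-- The entropy inequality for a process all of whose variables are functions of finitely many
of the finite-valued seeds. -/
theorem entropy_inequality_of_block {ι : Type*} {T : Finset ι} {σ : ι → Γ} {α : ι → ℝ} {β : ℝ}
    (hα : ∀ i ∈ T, 0 ≤ α i)
    (hβ : ∀ W : Finset Γ, β * (W.card : ℝ) ≤ ∑ i ∈ T, α i * ((W ∪ σ i • W).card : ℝ))
    {ζ : Γ → Ω → K} (hζ : ∀ v, Measurable (ζ v)) (hind : iIndepFun ζ P)
    {τ : Γ → Ω → Ω} (hτ : ∀ g, MeasurePreserving (τ g) P P)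
    (hτζ : ∀ g v ω, ζ v (τ g ω) = ζ (g * v) ω) {Y : Ω → A} {D : Finset Γ}
    (hY : ∃ φ : (D → K) → A, ∀ ω, Y ω = φ (jointVar ζ D ω)) :
    β * entropy P Y ≤ ∑ i ∈ T, α i * entropyPair P Y (fun ω => Y (τ (σ i) ω)) := by
  have hYm : Measurable Y := by
    obtain ⟨φ, hφ⟩ := hY
    rw [show Y = φ ∘ jointVar ζ D from funext hφ]
    exact (Measurable.of_discrete).comp (measurable_jointVar hζ D)
  have hYτm : ∀ g, Measurable fun ω => Y (τ g ω) := fun g => hYm.comp (hτ g).measurable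
  have hYker : ∀ ω ω', (∀ v ∈ D, ζ v ω = ζ v ω') → Y ω = Y ω' := by
    obtain ⟨φ, hφ⟩ := hY
    intro ω ω' h
    rw [hφ, hφ, jointVar_eq_iff.2 h]
  set w : Γ → ℝ := shapley (entropyGame P ζ Y) D with hw
  have hw0 : ∀ v, 0 ≤ w v := fun v => shapley_nonneg fun U => entropyGame_le_insert hζ hYm v U
  have hwD : ∀ v ∉ D, w v = 0 := fun v hv =>
    shapley_eq_zero_of_dummy fun U => entropyGame_insert_of_notMem hζ hind hY hv U
  have hsum : ∑ v ∈ D, w v = entropy P Y :=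
    sum_shapley_entropyGame fun ω ω' h => hYker ω ω' (jointVar_eq_iff.1 h)
  rw [← hsum]
  -- What remains, for each i, is that H(Y, Y ∘ τ) is at least the sum of the maxima.
  refine (mul_sum_le_sum_mul_sum_max hβ D w hw0 hwD).trans
    (Finset.sum_le_sum fun i hi => mul_le_mul_of_nonneg_left ?_ (hα i hi))
  set g := σ i
  have hmap : g • D = D.map (Equiv.mulLeft g).toEmbedding := by
    ext v; rw [← Finset.inv_smul_mem_iff]; simp
  have hYτ : ∃ φ : ((g • D : Finset Γ) → K) → A,
      ∀ ω, Y (τ g ω) = φ (jointVar ζ (g • D) ω) := by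
    obtain ⟨φ, hφ⟩ := hY
    refine ⟨fun k => φ fun u => k ⟨g * u, Finset.smul_mem_smul_finset u.2⟩, fun ω => ?_⟩
    rw [hφ]
    congr 1
    funext u
    exact hτζ g u ω
  have hpair : entropyPair P Y (fun ω => Y (τ g ω)) =
      ∑ v ∈ D ∪ g • D, shapley (entropyGame P ζ fun ω => (Y ω, Y (τ g ω))) (D ∪ g • D) v := by
    refine (sum_shapley_entropyGame fun ω ω' h => ?_).symm
    rw [jointVar_eq_iff] at h
    refine Prod.ext (hYker ω ω' fun v hv => h v (Finset.mem_union_left _ hv))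
      (hYker _ _ fun v hv => ?_)
    rw [hτζ, hτζ]
    exact h _ (Finset.mem_union_right _ (Finset.smul_mem_smul_finset hv))
  rw [hpair]
  refine Finset.sum_le_sum fun v _ => max_le ?_ ?_
  · rw [hw, ← shapley_eq_of_subset (Finset.subset_union_left (s₂ := g • D))
      fun d hd U => entropyGame_insert_of_notMem hζ hind hY hd U]
    exact shapley_mono fun U => entropyGame_marginal_le_prod hζ Y (hYτm g) v U
  -- By stationarity, the translated weight is the credit of v for Y ∘ τ, whose seeds lie in gD.
  · have e1 : w (g⁻¹ * v) = shapley (entropyGame P ζ fun ω => Y (τ g ω)) (g • D) v := by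
      have := shapley_map (Equiv.mulLeft g)
        (fun U => entropyGame_translate hζ (hτ g) (hτζ g) hYm U) D (g⁻¹ * v)
      rw [← hmap] at this
      simpa using this.symm
    rw [e1, ← shapley_eq_of_subset (Finset.subset_union_right (s₁ := D))
      fun d hd U => entropyGame_insert_of_notMem hζ hind hYτ hd U, entropyGame_prod_swap]
    exact shapley_mono fun U => entropyGame_marginal_le_prod hζ (fun ω => Y (τ g ω)) hYm v U

end Block

/-! ### Approximation by finite blocks -/

section Approximation

variable {Γ E A : Type*} [MeasurableSpace E]

/-- `Y` depends on finitely many coordinates, and on each of them only through a finite-valued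
measurable function. -/
def IsFiniteBlock (Y : (Γ → E) → A) : Prop :=
  ∃ (n : ℕ) (q : E → Fin n) (D : Finset Γ) (φ : (D → Fin n) → A),
    Measurable q ∧ ∀ z, Y z = φ fun v => q (z v)

theorem IsFiniteBlock.of_fintype {K : Type*} [Fintype K] [MeasurableSpace K]
    [MeasurableSingletonClass K] {q : E → K} (hq : Measurable q) {D : Finset Γ}
    (φ : (D → K) → A) : IsFiniteBlock fun z : Γ → E => φ fun v => q (z v) := by
  refine ⟨Fintype.card K, fun x => Fintype.equivFin K (q x), D,
    fun k => φ fun v => (Fintype.equivFin K).symm (k v), Measurable.of_discrete.comp hq, fun z => ?_⟩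
  simp

theorem IsFiniteBlock.measurable [MeasurableSpace A] {Y : (Γ → E) → A} (h : IsFiniteBlock Y) :
    Measurable Y := by
  obtain ⟨n, q, D, φ, hq, h⟩ := h
  rw [show Y = _ from funext h]
  exact (Measurable.of_discrete (f := φ)).comp
    (measurable_pi_lambda _ fun v => hq.comp (measurable_pi_apply _))

theorem IsFiniteBlock.comp {B : Type*} {Y : (Γ → E) → A} (h : IsFiniteBlock Y) (f : A → B) :
    IsFiniteBlock fun z => f (Y z) := by
  obtain ⟨n, q, D, φ, hq, h⟩ := h
  exact ⟨n, q, D, fun k => f (φ k), hq, fun z => congrArg f (h z)⟩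

/-- Take the union of the windows and quantise each seed by all the `q i` jointly. -/
theorem IsFiniteBlock.pi {ι : Type*} [Finite ι] {Y : ι → (Γ → E) → A}
    (h : ∀ i, IsFiniteBlock (Y i)) : IsFiniteBlock fun z i => Y i z := by
  classical
  have := Fintype.ofFinite ι
  choose n q D φ hq h using h
  have hD : ∀ i, D i ⊆ Finset.univ.biUnion D := fun i =>
    Finset.subset_biUnion_of_mem D (Finset.mem_univ i)
  have := IsFiniteBlock.of_fintype (q := fun x i => q i x) (measurable_pi_lambda _ hq)
    (D := Finset.univ.biUnion D) (fun k i => φ i fun v => k ⟨v, hD i v.2⟩ i)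
  convert this using 3 with z i
  exact h i z

theorem isSetRing_isFiniteBlock :
    IsSetRing {s : Set (Γ → E) | IsFiniteBlock fun z => z ∈ s} := by
  have pair : ∀ {s t : Set (Γ → E)} (f : Prop → Prop → Prop), (IsFiniteBlock fun z => z ∈ s) →
      (IsFiniteBlock fun z => z ∈ t) → IsFiniteBlock fun z => f (z ∈ s) (z ∈ t) := by
    intro s t f hs ht
    have := (IsFiniteBlock.pi (Y := fun (b : Bool) z => cond b (z ∈ s) (z ∈ t))
      (by rintro (_ | _) <;> assumption)).comp fun p => f (p true) (p false)
    exact this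
  refine ⟨?_, fun s t hs ht => ?_, fun s t hs ht => ?_⟩
  · exact ⟨1, fun _ => 0, ∅, fun _ => False, measurable_const, fun _ => rfl⟩
  · exact pair (fun p q => p ∨ q) hs ht
  · exact pair (fun p q => p ∧ ¬ q) hs ht

theorem generateFrom_isFiniteBlock : (MeasurableSpace.pi : MeasurableSpace (Γ → E)) =
    MeasurableSpace.generateFrom {s : Set (Γ → E) | IsFiniteBlock fun z => z ∈ s} := by
  refine le_antisymm (iSup_le fun v => ?_) (MeasurableSpace.generateFrom_le fun s hs => ?_)
  · rintro _ ⟨B, hB, rfl⟩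
    refine MeasurableSpace.measurableSet_generateFrom ?_
    exact IsFiniteBlock.of_fintype (q := fun x => x ∈ B) (measurableSet_setOfPred.1 hB) (D := {v})
      fun k => k ⟨v, Finset.mem_singleton_self v⟩
  · exact measurableSet_setOfPred.2 hs.measurable

/-- Approximate each level set of Y by a finite-block set `t a`. Off the union of the errors exactly
one `t a` contains z, the one with a = Y z, so choosing any such a recovers Y. -/
theorem exists_isFiniteBlock_approx {μ : Measure (Γ → E)} [IsFiniteMeasure μ] [Fintype A]
    [Nonempty A] [MeasurableSpace A] [MeasurableSingletonClass A] {Y : (Γ → E) → A}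
    (hY : Measurable Y) {ε : ℝ} (hε : 0 < ε) :
    ∃ Y' : (Γ → E) → A, IsFiniteBlock Y' ∧ μ.real {z | Y' z ≠ Y z} ≤ ε := by
  classical
  have hc : 0 < (Fintype.card A : ℝ) := by exact_mod_cast Fintype.card_pos
  have hδ : 0 < ε / Fintype.card A := div_pos hε hc
  have happ : ∀ a, ∃ t : Set (Γ → E), (IsFiniteBlock fun z => z ∈ t) ∧
      μ (symmDiff t (Y ⁻¹' {a})) < ENNReal.ofReal (ε / Fintype.card A) := fun a =>
    exists_measure_symmDiff_lt_of_generateFrom_isSetRing isSetRing_isFiniteBlock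
      ⟨{Set.univ}, Set.countable_singleton _, by
        rw [Set.singleton_subset_iff]
        exact ⟨1, fun _ => 0, ∅, fun _ => True, measurable_const, fun _ => rfl⟩, by simp⟩
      generateFrom_isFiniteBlock (hY (measurableSet_singleton a)) (ENNReal.ofReal_pos.2 hδ)
  choose t ht hμ using happ
  refine ⟨_, (IsFiniteBlock.pi ht).comp
    fun p => if h : ∃ a, p a then h.choose else Classical.arbitrary A, ?_⟩
  have hsub : {z | (if h : ∃ a, z ∈ t a then h.choose else Classical.arbitrary A) ≠ Y z} ⊆
      ⋃ a, symmDiff (t a) (Y ⁻¹' {a}) := by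
    intro z hz
    by_contra hne
    have hiff : ∀ a, z ∈ t a ↔ Y z = a := by
      intro a
      have h1 : z ∉ symmDiff (t a) (Y ⁻¹' {a}) := fun h => hne (Set.mem_iUnion.2 ⟨a, h⟩)
      rw [Set.mem_symmDiff, Set.mem_preimage, Set.mem_singleton_iff] at h1
      tauto
    have hex : ∃ a, z ∈ t a := ⟨Y z, (hiff _).2 rfl⟩
    refine hz ?_
    rw [dif_pos hex]
    exact ((hiff _).1 hex.choose_spec).symm
  refine (measureReal_mono hsub).trans ((measureReal_iUnion_fintype_le _).trans ?_)
  refine (Finset.sum_le_card_nsmul _ _ (ε / Fintype.card A) fun a _ => ?_).trans (le_of_eq ?_)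
  · exact ENNReal.toReal_le_of_le_ofReal hδ.le (hμ a).le
  · rw [Finset.card_univ, nsmul_eq_mul]; field_simp

end Approximation

/-! ### Passage to the limit on the product space -/

section Canonical

variable {Γ E A : Type*} [Group Γ] [MeasurableSpace E]
  [Fintype A] [MeasurableSpace A] [MeasurableSingletonClass A]

theorem measurePreserving_shift (ν : Measure E) [IsProbabilityMeasure ν] (g : Γ) :
    MeasurePreserving (shift g) (Measure.infinitePi fun _ : Γ => ν)
      (Measure.infinitePi fun _ : Γ => ν) where
  measurable := measurable_pi_lambda _ fun _ => measurable_pi_apply _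
  map_eq := Measure.map_infinitePi_infinitePi_of_inj (P := fun _ => ν) (mul_right_injective g⁻¹)

theorem entropy_inequality_of_factor [DecidableEq Γ] (ν : Measure E) [IsProbabilityMeasure ν]
    {ι : Type*} {T : Finset ι} {σ : ι → Γ} {α : ι → ℝ} {β : ℝ} (hα : ∀ i ∈ T, 0 ≤ α i)
    (hβ : ∀ W : Finset Γ, β * (W.card : ℝ) ≤ ∑ i ∈ T, α i * ((W ∪ σ i • W).card : ℝ))
    [Nonempty A] {Y : (Γ → E) → A} (hY : Measurable Y) :
    β * entropy (Measure.infinitePi fun _ : Γ => ν) Y ≤ ∑ i ∈ T, α i *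
      entropyPair (Measure.infinitePi fun _ : Γ => ν) Y (fun z => Y (shift (σ i)⁻¹ z)) := by
  set μ := Measure.infinitePi fun _ : Γ => ν with hμ
  have hτ : ∀ g : Γ, MeasurePreserving (shift g⁻¹) μ μ := fun g => measurePreserving_shift ν g⁻¹
  have hblock : ∀ {Y' : (Γ → E) → A}, IsFiniteBlock Y' → β * entropy μ Y' ≤
      ∑ i ∈ T, α i * entropyPair μ Y' (fun z => Y' (shift (σ i)⁻¹ z)) := by
    rintro Y' ⟨n, q, D, φ, hq, h⟩
    exact entropy_inequality_of_block (ζ := fun v (z : Γ → E) => q (z v)) hα hβ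
      (fun v => hq.comp (measurable_pi_apply v))
      (iIndepFun_infinitePi (P := fun _ : Γ => ν) (X := fun _ => q) fun _ => hq)
      (τ := fun g => shift g⁻¹) hτ (fun g v z => by simp [shift]) (D := D) ⟨φ, h⟩
  have hpos : ∀ n : ℕ, (0 : ℝ) < 1 / (n + 1) := fun n => Nat.one_div_pos_of_nat
  choose Yn hYn happ using fun n : ℕ => exists_isFiniteBlock_approx (μ := μ) hY (hpos n)
  have h0 : Filter.Tendsto (fun n : ℕ => (1 : ℝ) / (n + 1)) Filter.atTop (nhds 0) :=
    tendsto_one_div_add_atTop_nhds_zero_nat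
  -- The pair can err at either coordinate, and the shift preserves the measure, so its error bound
  -- is doubled.
  have h0' : Filter.Tendsto (fun n : ℕ => (1 : ℝ) / (n + 1) + 1 / (n + 1)) Filter.atTop
      (nhds 0) := by simpa using h0.add h0
  refine le_of_tendsto_of_tendsto' ((tendsto_entropy h0 happ).const_mul β)
    (tendsto_finsetSum _ fun i _ => Filter.Tendsto.const_mul (α i) ?_) fun n => hblock (hYn n)
  refine tendsto_entropy h0' fun n => ?_
  have hmeas : MeasurableSet {z | Yn n z ≠ Y z} :=
    ((hYn n).measurable.prodMk hY) (MeasurableSet.of_discrete (s := {p : A × A | p.1 ≠ p.2}))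
  have hsub : {z | (Yn n z, Yn n (shift (σ i)⁻¹ z)) ≠ (Y z, Y (shift (σ i)⁻¹ z))} ⊆
      {z | Yn n z ≠ Y z} ∪ shift (σ i)⁻¹ ⁻¹' {z | Yn n z ≠ Y z} := by
    intro z hz
    by_contra hne
    rw [Set.mem_union, not_or] at hne
    exact hz (Prod.ext (not_not.1 hne.1) (not_not.1 hne.2))
  refine (measureReal_mono hsub).trans ((measureReal_union_le _ _).trans ?_)
  rw [(hτ (σ i)).measureReal_preimage hmeas.nullMeasurableSet]
  exact add_le_add (happ n) (happ n)

end Canonical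

/-! ### Factors of IID and the final inequalities -/

section FactorOfIID

variable {Γ Ω A : Type*} [Group Γ] [MeasurableSpace Ω] [MeasurableSpace A] {P : Measure Ω}

theorem IsFactorOfIID.entropy_inequality [IsProbabilityMeasure P] [DecidableEq Γ] [Fintype A]
    [MeasurableSingletonClass A] {X : Γ → Ω → A} (hX : IsFactorOfIID P X) {ι : Type*}
    {T : Finset ι} {σ : ι → Γ} {α : ι → ℝ} {β : ℝ} (hα : ∀ i ∈ T, 0 ≤ α i)
    (hβ : ∀ W : Finset Γ, β * (W.card : ℝ) ≤ ∑ i ∈ T, α i * ((W ∪ σ i • W).card : ℝ)) :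
    β * entropy P (X 1) ≤ ∑ i ∈ T, α i * entropyPair P (X 1) (X (σ i)) := by
  obtain ⟨Z, F, hZ, hlaw, hind, hF, hequiv, hXF⟩ := hX
  have : Nonempty A := (nonempty_of_isProbabilityMeasure P).map (X 1)
  have hf : MeasurePreserving (fun ω v => Z v ω) P
      (Measure.infinitePi fun _ : Γ => (volume : Measure unitInterval)) :=
    ⟨measurable_pi_lambda _ hZ, by simp_rw [hind.map_fun_eq_infinitePi_map hZ, hlaw]⟩
  have hY : ∀ g, Measurable fun z => F z g := fun g => (measurable_pi_apply g).comp hF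
  have hYg : ∀ g z, F (shift g⁻¹ z) 1 = F z g := fun g z => by
    rw [hequiv]; simp [shift]
  have main := entropy_inequality_of_factor (volume : Measure unitInterval) hα hβ (hY 1)
  simp only [hYg, entropyPair] at main
  have e1 : entropy P (X 1) = entropy (Measure.infinitePi fun _ : Γ =>
      (volume : Measure unitInterval)) (fun z => F z 1) := by
    rw [← entropy_comp_measurePreserving hf (hY 1)]
    exact entropy_congr_ae (hXF.mono fun ω h => h 1)
  have e2 : ∀ g, entropyPair P (X 1) (X g) = entropy (Measure.infinitePi fun _ : Γ =>
      (volume : Measure unitInterval)) (fun z => (F z 1, F z g)) := fun g => by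
    rw [← entropy_comp_measurePreserving hf ((hY 1).prodMk (hY g))]
    exact entropy_congr_ae (hXF.mono fun ω h => Prod.ext (h 1) (h g))
  simpa only [e1, e2] using main

/-- The block is read by right multiplication, which commutes with the left translation action. -/
theorem IsFactorOfIID.blockProcess {X : Γ → Ω → A} (hX : IsFactorOfIID P X) (B : Finset Γ) :
    IsFactorOfIID P (blockProcess B X) := by
  obtain ⟨Z, F, hZ, hlaw, hind, hF, hequiv, hXF⟩ := hX
  refine ⟨Z, fun z γ b => F z (γ * b), hZ, hlaw, hind, ?_, fun g z => ?_, ?_⟩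
  · exact measurable_pi_lambda _ fun γ => measurable_pi_lambda _ fun b =>
      (measurable_pi_apply _).comp hF
  · funext γ b
    simp [hequiv, shift, mul_assoc]
  · filter_upwards [hXF] with ω h γ
    funext b
    exact h _

end FactorOfIID

theorem expansion_mul_card_le {Γ : Type*} [Group Γ] [DecidableEq Γ] {S : Finset Γ} {α : Γ → ℝ}
    (hα : ∀ σ ∈ S, 0 ≤ α σ) (W : Finset Γ) :
    expansion S α * (W.card : ℝ) ≤ ∑ σ ∈ S, α σ * ((W ∪ σ • W).card : ℝ) := by
  -- This bounds the quotients below by 0, which the infimum in ℝ needs in order to be a genuine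
  -- lower bound.
  have hnonneg : ∀ W : Finset Γ, 0 ≤ ∑ σ ∈ S, α σ * ((W ∪ σ • W).card : ℝ) := fun W =>
    Finset.sum_nonneg fun σ hσ => mul_nonneg (hα σ hσ) (Nat.cast_nonneg _)
  rcases W.eq_empty_or_nonempty with rfl | hW
  · simp
  · rw [← le_div_iff₀ (by exact_mod_cast hW.card_pos)]
    exact ciInf_le (f := fun W : {W : Finset Γ // W.Nonempty} =>
      (∑ σ ∈ S, α σ * ((W.1 ∪ σ • W.1).card : ℝ)) / (W.1.card : ℝ))
      ⟨0, by rintro _ ⟨W, rfl⟩; exact div_nonneg (hnonneg _) (Nat.cast_nonneg _)⟩ ⟨W, hW⟩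

theorem theorem3p4 {Γ : Type*} [Group Γ] [Infinite Γ] [DecidableEq Γ]
    (S : Finset Γ) (hSgen : Subgroup.closure (S : Set Γ) = ⊤)
    (hSsymm : ∀ σ ∈ S, σ⁻¹ ∈ S)
    {M : Type*} [Fintype M] [MeasurableSpace M] [MeasurableSingletonClass M]
    {Ω : Type*} [MeasurableSpace Ω] (P : Measure Ω) [IsProbabilityMeasure P]
    (X : Γ → Ω → M) (hX : IsFactorOfIID P X) :
    (∀ α : Γ → ℝ, (∀ σ ∈ S, 0 ≤ α σ) → (∀ σ ∈ S, α σ = α σ⁻¹) →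
      expansion S α * entropy P (X 1) ≤ ∑ σ ∈ S, α σ * entropyPair P (X 1) (X σ)) ∧
    (∀ (r : ℕ) (s : FreeGroupBasis (Fin r) Γ), 0 ≤ bowenFInvariant P s X) := by
  refine ⟨fun α hα _ => hX.entropy_inequality (σ := id) hα (expansion_mul_card_le hα),
    fun r s => le_iInf fun n => EReal.coe_nonneg.2 ?_⟩
  -- With unit weights and β = 2r - 1, the inequality is the nonnegativity of the n-th term of the
  -- infimum.
  have h := (hX.blockProcess (wordBall s n)).entropy_inequality (T := Finset.univ) (σ := s)
    (α := fun _ => 1) (β := 2 * (r : ℝ) - 1) (fun _ _ => zero_le_one)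
    (fun W => by simpa using s.mul_card_le_sum_card_union_smul W)
  simp only [one_mul] at h
  unfold bowenF
  linarith
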